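/- Notation: for $A,B\subseteq\omega$ write $A\subseteq^*B$ if $A\setminus B$ is finite, and $A\subsetneq^*B$ if moreover $B\setminus A$ is infinite. A *tower* indexed by a set $I$ of ordinals is a sequence $\langle T_\alpha:\alpha\in I\rangle$ of subsets of $\omega$ such that $T_\beta\subsetneq^*T_\alpha$ for all $\beta<\alpha$ in $I$. A *subtower* of $\langle T_\alpha:\alpha\in I\rangle$ is a tower $\langle S_\alpha:\alpha\in I\rangle$ such that $S_\alpha\subseteq T_\alpha$ for all $\alpha\in I$ and $S_\alpha\cap(T_\beta\setminus S_\beta)$ is finite for all $\beta<\alpha$ in $I$. Let $\Lambda$ be the set of all countable (nonzero) limit ordinals. A *ladder system* $\langle\varphi_\lambda:\lambda\in\Lambda\rangle$ assigns to each $\lambda\in\Lambda$ a strictly increasing $\omega$-sequence $\varphi_\lambda$ of ordinals below $\lambda$ that is cofinal in $\lambda$; $\beta\in\varphi_\lambda$ means that $\beta$ is a term of this sequence. **Theorem (The $\aleph_1$ Gap Theorem, in ZFC).** Let the following be given: (G1) a tower $T=\langle T_\alpha:\alpha<\omega_1\rangle$ with $T_0=\emptyset$; (G2) a ladder system $\langle\varphi_\lambda:\lambda\in\Lambda\rangle$;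 (G3) pairwise disjoint stationary (in $\omega_1$) sets $S(\xi,\eta)\subseteq\Lambda$, for $\eta<\xi<\omega_1$, such that every $\lambda\in\Lambda$ lies in some $S(\xi,\eta)$, and $\lambda\in S(\xi,\eta)$ implies $\eta<\xi<\lambda$. Then there is a collection $\langle A(\xi,\alpha):\xi<\alpha<\omega_1\rangle$ of subsets of $\omega$ (where we put $A(\xi,\alpha)=\emptyset$ for $\alpha\le\xi<\omega_1$) such that 1. for every $\xi<\omega_1$, $\langle A(\xi,\alpha):\xi<\alpha<\omega_1\rangle$ is a subtower of $\langle T_\alpha:\xi<\alpha<\omega_1\rangle$; 2. for every $\alpha<\omega_1$, $T_\alpha=\bigcup\{A(\xi,\alpha):\xi<\alpha\}$, and this union is disjoint; 3. for all $\eta<\xi<\omega_1$, all $\lambda\in S(\xi,\eta)$ and all $\beta\in\varphi_\lambda$ with $\beta>\eta$, $A(\xi,\lambda)\cap A(\eta,\beta)\neq\emptyset$; 4. for all $\beta<\alpha<\omega_1$, the set $\{\xi<\omega_1:A(\xi,\beta)\not\subseteq A(\xi,\alpha)\}$ is finite. -/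

import Mathlib

open Set Ordinal

/-- The ordinal `ω₁`, viewed as the well-ordered set of all countable ordinals. -/
abbrev Omega1 : Type 1 := Set.Iio (ω₁ : Ordinal.{0})

/-- `A ⊆* B`: almost inclusion of subsets of `ω`, i.e. `A \ B` is finite. -/
def AlmostSubset (A B : Set ℕ) : Prop := (A \ B).Finite

/-- `A ⊊* B`: `A` is almost included in `B`, and `B \ A` is infinite. -/
def AlmostSSubset (A B : Set ℕ) : Prop := AlmostSubset A B ∧ (B \ A).Infinite

/-- A tower in `P(ω)` indexed by a (well-)ordered set `I`: a sequence of subsets of `ω` that is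
strictly increasing modulo finite sets. -/
def IsTower {I : Type*} [LinearOrder I] (T : I → Set ℕ) : Prop :=
  ∀ β α : I, β < α → AlmostSSubset (T β) (T α)

/-- `S` is a subtower of `T`: it is a tower, it is levelwise included in `T`, and restriction to
lower levels is faithful, i.e. `S_α ∩ (T_β \ S_β)` is finite for `β < α`. -/
structure IsSubtower {I : Type*} [LinearOrder I] (S T : I → Set ℕ) : Prop where
  isTower : IsTower S
  subset : ∀ α : I, S α ⊆ T α
  faithful : ∀ β α : I, β < α → (S α ∩ (T β \ S β)).Finite

/-- The set `Λ` of all countable limit ordinals (`0` is not a limit ordinal). -/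
def countableLimits : Set Omega1 := {l | Order.IsSuccLimit (l : Ordinal.{0})}

/-- `⟨φ_l : l ∈ Γ⟩` is a ladder system on a set `Γ` of countable limit ordinals: each `φ_l` is a
strictly increasing `ω`-sequence of ordinals below `l`, cofinal in `l`. Only the values of `φ` at
elements of `Γ` matter. -/
structure IsLadderSystem (Γ : Set Omega1) (φ : Omega1 → ℕ → Omega1) : Prop where
  limit : Γ ⊆ countableLimits
  strictMono : ∀ l ∈ Γ, StrictMono (φ l)
  lt : ∀ l ∈ Γ, ∀ n, φ l n < l
  cofinal : ∀ l ∈ Γ, ∀ γ < l, ∃ n, γ ≤ φ l n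

/-!
A family of partitions `T α = ⋃ ξ < α, A ξ α` is the same thing as a family of colourings
`c α : T α → α`, where `A ξ α` is the set of points of `T α` of colour `ξ`. In these terms, the
subtower condition together with the finiteness of `{ξ | ¬ A ξ β ⊆ A ξ α}` follows from two
properties of the colourings, for `β < α`:

* coherence: `c α` and `c β` disagree only at finitely many points of `T β`;
* richness: `c α` takes every value `ξ < α` infinitely often on `T α \ T β`.

The colourings are constructed by recursion on `α` (`exists_transfinite_choice`). At a successor
`γ + 1`, keep `c γ` on `T γ` and use every colour infinitely often on the infinite set
`T (γ + 1) \ T γ` (`ColouringStep.exists_succ`). At a limit `l` in `S ξ η` with ladder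
`β₀ < β₁ < ⋯`, colour each point by `c (β k)` for the least `k` such that the point lies in
`T (β k)`; this is coherent with all earlier colourings. By richness of `c (β k)` there is, for
each `k` with `η < β k`, a point `m k` of `T l ∩ T (β k)` of `c (β k)`-colour `η` that lies outside
`T (β j)` for every `j < k`. Recolouring every `m k` with `ξ` secures the prescribed intersections,
and coherence survives because each `T (β j)` contains only finitely many of the points `m k`
(`ColouringStep.exists_limit`). Disjointness of the sets `S ξ η` guarantees that only one pair
`(ξ, η)` has to be served at `l`.
-/

/-! ### Choice along a well-order -/

/-- Transfinite dependent choice. The relation `P i f x` says that `x` is an admissible value at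
`i`, given the values of `f` below `i`. -/
theorem exists_transfinite_choice {I X : Type*} [LinearOrder I] [WellFoundedLT I] [Nonempty X]
    (P : I → (I → X) → X → Prop)
    (hcongr : ∀ i f g x, (∀ j < i, f j = g j) → P i f x → P i g x)
    (hstep : ∀ i f, (∀ j < i, P j f (f j)) → ∃ x, P i f x) :
    ∃ f : I → X, ∀ i, P i f (f i) := by
  classical
  let ext : ∀ i : I, (∀ j, j < i → X) → I → X := fun i r j =>
    if h : j < i then r j h else Classical.arbitrary X
  let step : ∀ i : I, (∀ j, j < i → X) → X := fun i r =>
    if h : ∃ x, P i (ext i r) x then h.choose else Classical.arbitrary X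
  let f : I → X := (wellFounded_lt (α := I)).fix step
  have hf : ∀ i, f i = step i fun j _ => f j := fun i => WellFounded.fix_eq _ _ _
  refine ⟨f, fun i => ?_⟩
  induction i using WellFoundedLT.induction with
  | ind i ih =>
    have hext : ∀ j < i, f j = ext i (fun j _ => f j) j := fun j hj => by simp [ext, hj]
    obtain ⟨x, hx⟩ := hstep i f ih
    have hex : ∃ x, P i (ext i fun j _ => f j) x := ⟨x, hcongr _ _ _ _ hext hx⟩
    have hfi : f i = hex.choose := by rw [hf i]; exact dif_pos hex
    rw [hfi]
    exact hcongr _ _ _ _ (fun j hj => (hext j hj).symm) hex.choose_spec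

/-! ### Colouring an infinite set with countably many colours -/

theorem countable_Iio_Omega1 (α : Omega1) : (Set.Iio α).Countable := by
  have h1 : (Set.Iio (α : Ordinal.{0})).Countable := by
    rw [← Cardinal.le_aleph0_iff_set_countable, Cardinal.mk_Iio_ordinal, Cardinal.lift_le_aleph0,
      ← Cardinal.lt_aleph_one_iff]
    exact Cardinal.lt_omega_iff_card_lt.1 α.2
  exact (h1.preimage Subtype.val_injective).mono fun β hβ => hβ

theorem exists_colouring_infinite_fibres {X : Type*} {D : Set ℕ} (hD : D.Infinite) {C : Set X}
    (hC : C.Countable) (hne : C.Nonempty) :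
    ∃ g : ℕ → X, (∀ n, g n ∈ C) ∧ ∀ x ∈ C, {n ∈ D | g n = x}.Infinite := by
  classical
  obtain ⟨e, rfl⟩ := hC.exists_eq_range hne
  have hD' : (Set.ofPred (· ∈ D)).Infinite := hD
  refine ⟨fun n => e (Nat.unpair (Nat.count (· ∈ D) n)).1, fun n => ⟨_, rfl⟩, ?_⟩
  rintro _ ⟨i, rfl⟩
  -- the elements of `D` whose position in `D` has the form `Nat.pair i j`
  refine (Set.infinite_range_of_injective (f := fun j => Nat.nth (· ∈ D) (Nat.pair i j))
    fun a b h => ?_).mono ?_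
  · exact (Nat.pair_eq_pair.1 (Nat.nth_injective hD' h)).2
  · rintro _ ⟨j, rfl⟩
    exact ⟨Nat.nth_mem_of_infinite hD' _, by simp [Nat.count_nth_of_infinite hD']⟩

/-! ### The inductive step of the construction -/

/-- `ColouringStep T φ S f α c`: the colouring `c` of `T α` is an admissible choice at stage `α`,
given the colourings `f β` of `T β` for `β < α`. Colourings are total functions on `ℕ`, of which
only the restriction to the relevant level of the tower matters. -/
structure ColouringStep (T : Omega1 → Set ℕ) (φ : Omega1 → ℕ → Omega1)
    (S : Omega1 → Omega1 → Set Omega1) (f : Omega1 → ℕ → Omega1) (α : Omega1)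
    (c : ℕ → Omega1) : Prop where
  lt : ∀ n ∈ T α, c n < α
  coherent : ∀ β < α, {n ∈ T β | f β n ≠ c n}.Finite
  rich : ∀ β < α, ∀ ξ < α, {n ∈ T α | n ∉ T β ∧ c n = ξ}.Infinite
  meets : ∀ ξ η, η < ξ → α ∈ S ξ η → ∀ k, η < φ α k →
    ∃ n ∈ T α, n ∈ T (φ α k) ∧ c n = ξ ∧ f (φ α k) n = η

namespace ColouringStep

variable {T : Omega1 → Set ℕ} {φ : Omega1 → ℕ → Omega1} {S : Omega1 → Omega1 → Set Omega1}
  {f g : Omega1 → ℕ → Omega1} {α : Omega1}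

theorem congr (hφ : IsLadderSystem countableLimits φ)
    (hSsub : ∀ ξ η, η < ξ → S ξ η ⊆ countableLimits) {c : ℕ → Omega1}
    (hfg : ∀ β < α, f β = g β) (h : ColouringStep T φ S f α c) : ColouringStep T φ S g α c where
  lt := h.lt
  coherent β hβ := hfg β hβ ▸ h.coherent β hβ
  rich := h.rich
  meets ξ η hηξ hα k hk := by
    rw [← hfg _ (hφ.lt α (hSsub ξ η hηξ hα) k)]
    exact h.meets ξ η hηξ hα k hk

theorem exists_succ (hT : IsTower T) (hSsub : ∀ ξ η, η < ξ → S ξ η ⊆ countableLimits)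
    {γ : Omega1} (hγ : γ < α) (hle : ∀ β < α, β ≤ γ) (hα : α ∉ countableLimits)
    (h : ColouringStep T φ S f γ (f γ)) : ∃ c, ColouringStep T φ S f α c := by
  classical
  obtain ⟨g, hg, hginf⟩ := exists_colouring_infinite_fibres (hT γ α hγ).2
    (countable_Iio_Omega1 α) ⟨γ, hγ⟩
  refine ⟨fun n => if n ∈ T γ then f γ n else g n, ?_, ?_, ?_, ?_⟩
  · intro n _
    split_ifs with hn
    exacts [(h.lt n hn).trans hγ, hg n]
  · intro β hβ
    obtain rfl | hβγ := (hle β hβ).eq_or_lt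
    · refine Set.finite_empty.subset ?_
      rintro n ⟨hn, hne⟩
      simp [hn] at hne
    · refine ((h.coherent β hβγ).union (hT β γ hβγ).1).subset ?_
      rintro n ⟨hn, hne⟩
      by_cases hnγ : n ∈ T γ
      · exact Or.inl ⟨hn, by simpa [hnγ] using hne⟩
      · exact Or.inr ⟨hn, hnγ⟩
  · intro β hβ ξ hξ
    have hfin : (T β \ T γ).Finite := by
      obtain rfl | hβγ := (hle β hβ).eq_or_lt
      · simp
      · exact (hT β γ hβγ).1
    refine ((hginf ξ hξ).sdiff hfin).mono ?_
    rintro n ⟨⟨⟨hnα, hnγ⟩, hn⟩, hnβ⟩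
    exact ⟨hnα, fun hb => hnβ ⟨hb, hnγ⟩, by simpa [hnγ] using hn⟩
  · exact fun ξ η hηξ hmem => absurd (hSsub ξ η hηξ hmem) hα

/-- Along an increasing sequence of stages, every colour available at stage `b k` is taken
infinitely often on the part of `T (b k)` that avoids all the levels `T (b j)`, `j < k`. -/
theorem infinite_new_points (hT : IsTower T) {b : ℕ → Omega1} (hb : StrictMono b) {η : Omega1}
    {k : ℕ} (hη : η < b k) (h : ColouringStep T φ S f (b k) (f (b k))) :
    {n ∈ T (b k) | (∀ j < k, n ∉ T (b j)) ∧ f (b k) n = η}.Infinite := by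
  obtain ⟨γ, hγ, hle⟩ : ∃ γ < b k, ∀ j < k, b j ≤ γ := by
    cases k with
    | zero => exact ⟨η, hη, by simp⟩
    | succ k => exact ⟨b k, hb k.lt_succ_self, fun j hj => hb.monotone (Nat.le_of_lt_succ hj)⟩
  have hfin : (⋃ j ∈ Set.Iio k, T (b j) \ T γ).Finite := by
    refine (Set.finite_Iio k).biUnion fun j hj => ?_
    obtain heq | hlt := (hle j hj).eq_or_lt
    · simp [heq]
    · exact (hT _ _ hlt).1
  refine ((h.rich γ hγ η hη).sdiff hfin).mono ?_
  rintro n ⟨⟨hn, hnγ, hc⟩, hnot⟩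
  exact ⟨hn, fun j hj hnj => hnot (Set.mem_biUnion hj ⟨hnj, hnγ⟩), hc⟩

theorem exists_limit (hT : IsTower T) (hφ : IsLadderSystem countableLimits φ)
    (hSdisj : ∀ ξ η ξ' η', η < ξ → η' < ξ' → (ξ, η) ≠ (ξ', η') → Disjoint (S ξ η) (S ξ' η'))
    (hα : α ∈ countableLimits) {ξ η : Omega1} (hηξ : η < ξ) (hξα : ξ < α) (hmem : α ∈ S ξ η)
    (h : ∀ β < α, ColouringStep T φ S f β (f β)) : ∃ c, ColouringStep T φ S f α c := by
  classical
  set b := φ α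
  have hb : StrictMono b := hφ.strictMono α hα
  have hbα : ∀ k, b k < α := hφ.lt α hα
  have hcof : ∀ γ < α, ∃ k, γ < b k := fun γ hγ => by
    obtain ⟨k, hk⟩ := hφ.cofinal α hα γ hγ
    exact ⟨k + 1, hk.trans_lt (hb k.lt_succ_self)⟩
  have hm : ∀ k, ∃ n, η < b k → n ∈ T α ∧ n ∈ T (b k) ∧ (∀ j < k, n ∉ T (b j)) ∧ f (b k) n = η := by
    intro k
    by_cases hk : η < b k
    · obtain ⟨n, ⟨hn, hnew, hc⟩, hnot⟩ := ((infinite_new_points hT hb hk (h _ (hbα k))).sdiff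
        (hT _ _ (hbα k)).1).nonempty
      exact ⟨n, fun _ => ⟨by_contra fun hnα => hnot ⟨hn, hnα⟩, hn, hnew, hc⟩⟩
    · exact ⟨0, fun hk' => absurd hk' hk⟩
  -- only finitely many of the points `m k` lie in a given `T (b j)`, so recolouring them is harmless
  choose m hm using hm
  -- the colour inherited from the first rung whose level contains the point
  let c₀ : ℕ → Omega1 := fun n => if hn : ∃ k, n ∈ T (b k) then f (b (Nat.find hn)) n else ξ
  let c : ℕ → Omega1 := fun n => if ∃ k, η < b k ∧ m k = n then ξ else c₀ n
  have hrung : ∀ j, {n ∈ T (b j) | f (b j) n ≠ c n}.Finite := by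
    intro j
    have h1 : (⋃ i ∈ Set.Iic j, {n ∈ T (b i) | f (b i) n ≠ f (b j) n}).Finite := by
      refine (Set.finite_Iic j).biUnion fun i hi => ?_
      obtain rfl | hij := (Set.mem_Iic.1 hi).eq_or_lt
      · simp
      · exact (h _ (hbα j)).coherent _ (hb hij)
    refine (((Set.finite_Iic j).image m).union h1).subset ?_
    rintro n ⟨hn, hne⟩
    by_cases hex : ∃ k, η < b k ∧ m k = n
    · obtain ⟨k, hk, rfl⟩ := hex
      exact Or.inl ⟨k, not_lt.1 fun hjk => (hm k hk).2.2.1 j hjk hn, rfl⟩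
    · have hn' : ∃ k, n ∈ T (b k) := ⟨j, hn⟩
      have hc : c n = f (b (Nat.find hn')) n := by simp only [c, c₀, if_neg hex, dif_pos hn']
      exact Or.inr (Set.mem_biUnion (x := Nat.find hn') (Nat.find_min' hn' hn)
        ⟨Nat.find_spec hn', fun heq => hne (by rw [hc, heq])⟩)
  refine ⟨c, ?_, ?_, ?_, ?_⟩
  · intro n _
    by_cases hex : ∃ k, η < b k ∧ m k = n
    · simpa only [c, if_pos hex] using hξα
    · by_cases hn : ∃ k, n ∈ T (b k)
      · simp only [c, c₀, if_neg hex, dif_pos hn]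
        exact ((h _ (hbα _)).lt n (Nat.find_spec hn)).trans (hbα _)
      · simpa only [c, c₀, if_neg hex, dif_neg hn] using hξα
  · intro β hβ
    obtain ⟨j, hj⟩ := hcof β hβ
    refine ((((h _ (hbα j)).coherent β hj).union (hT β _ hj).1).union (hrung j)).subset ?_
    rintro n ⟨hn, hne⟩
    by_cases hnj : n ∈ T (b j)
    · by_cases heq : f β n = f (b j) n
      · exact Or.inr ⟨hnj, heq ▸ hne⟩
      · exact Or.inl (Or.inl ⟨hn, heq⟩)
    · exact Or.inl (Or.inr ⟨hn, hnj⟩)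
  · intro β hβ ζ hζ
    obtain ⟨j, hj⟩ := hcof (max β ζ) (max_lt hβ hζ)
    obtain ⟨hβj, hζj⟩ := max_lt_iff.1 hj
    refine (((h _ (hbα j)).rich β hβj ζ hζj).sdiff ((hT _ _ (hbα j)).1.union (hrung j))).mono ?_
    rintro n ⟨⟨hn, hnβ, hc⟩, hnot⟩
    exact ⟨by_contra fun hnα => hnot (Or.inl ⟨hn, hnα⟩), hnβ,
      by_contra fun hne => hnot (Or.inr ⟨hn, fun heq => hne (heq ▸ hc)⟩)⟩
  · intro ξ' η' hηξ' hmem' k hk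
    obtain ⟨rfl, rfl⟩ : ξ = ξ' ∧ η = η' := by
      by_contra hne
      exact Set.disjoint_left.1 (hSdisj ξ η ξ' η' hηξ hηξ' fun heq => hne (Prod.mk.inj heq))
        hmem hmem'
    obtain ⟨h1, h2, -, h3⟩ := hm k hk
    exact ⟨m k, h1, h2, if_pos ⟨k, hk, rfl⟩, h3⟩

end ColouringStep

/-! ### From colourings to the matrix -/

theorem theorem41
    -- a tower of height `ω₁` with empty bottom level
    (T : Omega1 → Set ℕ) (hT : IsTower T)
    (hT0 : T ⟨0, Ordinal.omega_pos 1⟩ = ∅)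
    -- a ladder system on the countable limit ordinals
    (φ : Omega1 → ℕ → Omega1) (hφ : IsLadderSystem countableLimits φ)
    -- disjoint stationary sets `S ξ η`, `η < ξ < ω₁`, of limit ordinals, covering them all
    (S : Omega1 → Omega1 → Set Omega1)
    (hSsub : ∀ ξ η, η < ξ → S ξ η ⊆ countableLimits)
    (hSstat : ∀ ξ η, η < ξ → IsStationary (S ξ η))
    (hSdisj : ∀ ξ η ξ' η', η < ξ → η' < ξ' → (ξ, η) ≠ (ξ', η') → Disjoint (S ξ η) (S ξ' η'))
    (hScover : ∀ l ∈ countableLimits, ∃ ξ η, η < ξ ∧ l ∈ S ξ η)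
    (hSlt : ∀ ξ η, η < ξ → ∀ l ∈ S ξ η, ξ < l) :
    ∃ A : Omega1 → Omega1 → Set ℕ,
      -- the matrix is upper triangular: only the entries with `ξ < α` matter
      (∀ ξ α, α ≤ ξ → A ξ α = ∅) ∧
      -- each column `⟨A ξ α : ξ < α < ω₁⟩` is a subtower of `T`
      (∀ ξ, IsSubtower (fun α : Set.Ioi ξ => A ξ α) (fun α : Set.Ioi ξ => T α)) ∧
      -- each row is a partition of `T α`
      (∀ α, T α = (⋃ ξ ∈ Set.Iio α, A ξ α) ∧
        (Set.Iio α).PairwiseDisjoint (fun ξ => A ξ α)) ∧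
      -- prescribed intersections
      (∀ ξ η, η < ξ → ∀ l ∈ S ξ η, ∀ β ∈ Set.range (φ l), η < β → (A ξ l ∩ A η β).Nonempty) ∧
      -- true inclusion between two rows in all but finitely many columns
      (∀ β α, β < α → {ξ | ¬ A ξ β ⊆ A ξ α}.Finite) := by
  have : Nonempty Omega1 := ⟨⟨0, Ordinal.omega_pos 1⟩⟩
  obtain ⟨c, hc⟩ : ∃ c : Omega1 → ℕ → Omega1, ∀ α, ColouringStep T φ S c α (c α) := by
    refine exists_transfinite_choice (fun α f => ColouringStep T φ S f α)
      (fun α f g x hfg hx => ColouringStep.congr hφ hSsub hfg hx) fun α f ih => ?_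
    by_cases hα : α ∈ countableLimits
    · obtain ⟨ξ, η, hηξ, hmem⟩ := hScover α hα
      exact ColouringStep.exists_limit hT hφ hSdisj hα hηξ (hSlt ξ η hηξ α hmem) hmem ih
    obtain h0 | ⟨γ, hγ⟩ | hlim := Ordinal.zero_or_succ_or_isSuccLimit (α : Ordinal.{0})
    · have hα0 : α = ⟨0, Ordinal.omega_pos 1⟩ := Subtype.ext h0
      have hnlt : ∀ β, ¬ β < α := fun β hβ =>
        not_lt_bot (a := (β : Ordinal.{0})) (by rw [Ordinal.bot_eq_zero, ← h0]; exact hβ)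
      refine ⟨fun _ => α, ?_, fun β hβ => absurd hβ (hnlt β), fun β hβ => absurd hβ (hnlt β),
        fun ξ η hηξ hmem => absurd (hSsub ξ η hηξ hmem) hα⟩
      simp [hα0, hT0]
    · have hγα : γ < α.1 := hγ ▸ Order.lt_succ γ
      refine ColouringStep.exists_succ (γ := ⟨γ, hγα.trans α.2⟩) hT hSsub hγα (fun β hβ => ?_) hα
        (ih _ hγα)
      have hβ' : β.1 < Order.succ γ := hγ ▸ hβ
      exact show β.1 ≤ γ from Order.lt_succ_iff.1 hβ'
    · exact absurd hlim hα
  -- a point of `T β` whose colour changes between stages `β` and `α` is one of finitely many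
  have hchange : ∀ β α, β < α → ∀ s : Set ℕ,
      (∀ n ∈ s, n ∈ T β ∧ (n ∈ T α → c β n ≠ c α n)) → s.Finite := fun β α hβα s hs =>
    (((hT β α hβα).1).union ((hc α).coherent β hβα)).subset fun n hn => by
      by_cases hnα : n ∈ T α
      · exact Or.inr ⟨(hs n hn).1, (hs n hn).2 hnα⟩
      · exact Or.inl ⟨(hs n hn).1, hnα⟩
  refine ⟨fun ξ α => {n ∈ T α | c α n = ξ}, ?_, ?_, ?_, ?_, ?_⟩
  · intro ξ α hαξ
    refine Set.eq_empty_of_forall_notMem ?_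
    rintro n ⟨hn, rfl⟩
    exact hαξ.not_gt ((hc α).lt n hn)
  · refine fun ξ => ⟨fun β α hβα => ⟨?_, ?_⟩, fun α => Set.sep_subset _ _, fun β α hβα => ?_⟩
    · refine hchange β α hβα _ ?_
      rintro n ⟨⟨hn, hnξ⟩, hnot⟩
      exact ⟨hn, fun hnα heq => hnot ⟨hnα, heq ▸ hnξ⟩⟩
    · refine ((hc α).rich β hβα ξ α.2).mono ?_
      rintro n ⟨hn, hnβ, hnξ⟩
      exact ⟨⟨hn, hnξ⟩, fun h => hnβ h.1⟩
    · refine hchange β α hβα _ ?_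
      rintro n ⟨⟨_, hnξ⟩, hn, hnot⟩
      exact ⟨hn, fun _ heq => hnot ⟨hn, heq.trans hnξ⟩⟩
  · refine fun α => ⟨?_, ?_⟩
    · ext n
      simp only [Set.mem_iUnion, Set.mem_Iio, Set.mem_ofPred_eq, exists_prop]
      exact ⟨fun hn => ⟨c α n, (hc α).lt n hn, hn, rfl⟩, fun ⟨_, _, hn, _⟩ => hn⟩
    · intro ξ _ ζ _ hne
      refine Set.disjoint_left.2 ?_
      rintro n ⟨_, rfl⟩ ⟨_, rfl⟩
      exact hne rfl
  · rintro ξ η hηξ l hl _ ⟨k, rfl⟩ hk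
    obtain ⟨n, h1, h2, h3, h4⟩ := (hc l).meets ξ η hηξ hl k hk
    exact ⟨n, ⟨h1, h3⟩, h2, h4⟩
  · -- a column in which inclusion fails is the `β`-colour of a point whose colour changes
    intro β α hβα
    refine ((((hT β α hβα).1).union ((hc α).coherent β hβα)).image (c β)).subset ?_
    intro ξ hξ
    obtain ⟨n, ⟨hn, hnξ⟩, hnot⟩ := Set.not_subset.1 hξ
    refine ⟨n, ?_, hnξ⟩
    by_cases hnα : n ∈ T α
    · exact Or.inr ⟨hn, fun heq => hnot ⟨hnα, heq ▸ hnξ⟩⟩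
    · exact Or.inl ⟨hn, hnα⟩
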